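/- **Setting.** Let $n\ge 2$ and $b\ge 0$ be integers. Write $x\in\mathbb F_2^{nb}$ as $x=(x_{i,j})_{i\in[n],\,j\in[b]}$, with blocks $x(i)=(x_{i,1},\dots,x_{i,b})$. Let $\alpha>0$ with $b\ge \frac{250}{\alpha}\ln n$, and let $g:\mathbb F_2^b\to\mathbb F_2$ be a gadget all of whose Fourier coefficients are small: for all $S\subseteq[b]$, $$\Bigl|\mathbb E_{x\in\mathbb F_2^b}\bigl[(-1)^{g(x)+\sum_{i\in S}x_i}\bigr]\Bigr|\le 2^{-\alpha b}.$$ Let $G(x)=(g(x(1)),\dots,g(x(n)))$ be the blockwise application of $g$; $G$ is applied in the same way to assignments to the blocks in a subset of $[n]$. **Closures.** A set $V$ of vectors over $\mathbb F_2$ whose coordinates are grouped in blocks is *safe* if, for every $k$, the supports of any $k$ linearly independent vectors in $\mathrm{span}(V)$ together meet at least $k$ distinct blocks. For $V\subseteq\mathbb F_2^{nb}$, the closure $\mathrm{Cl}(V)$ is the (unique) minimal $S\subseteq[n]$ such that the projections of the vectors of $V$ to the coordinates in the blocks outside $S$ form a safe set. A set $S\subseteq[n]$ of blocks is *acceptable*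 for $V$ if, in the matrix $M$ with the vectors of $V$ as rows, one can choose one column in each block of $S$ so that the chosen columns are linearly independent. The amortized closure $\widehat{\mathrm{Cl}}(V)$ is the lexicographically largest acceptable set (sets being compared through their indicator strings). For an affine space $A=\{x : Mx=c\}$, $\mathrm{Cl}(A)$ and $\widehat{\mathrm{Cl}}(A)$ are the closure and the amortized closure of the set of rows of $M$; they do not depend on the choice of $M$. **Statement.** Let $B\subseteq A\subseteq\mathbb F_2^{nb}$ be affine subspaces with $|\widehat{\mathrm{Cl}}(B)|=|\widehat{\mathrm{Cl}}(A)|+k$. Let $y$ be an assignment to the variables $x_{i,j}$, $i\in\mathrm{Cl}(A)$, $j\in[b]$, that is extendable for $A$, i.e. some point of $A$ agrees with $y$ on these variables, and let $C_y$ be the set of all $x\in\mathbb F_2^{nb}$ that agree with $y$. Let $z\in\mathbb F_2^n$ satisfy $G(y)=z|_{\mathrm{Cl}(A)}$. Then, for $x$ uniform on $G^{-1}(z)\cap C_y$, the event $x\in A$ has positive probability, and $$\Pr_{x\sim G^{-1}(z)\cap C_y}\bigl[x\in B \,\big|\, x\in A\bigr]\le\left(\tfrac34\right)^k .$$ -/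

import Mathlib

/-- Vectors over `F_2` made of blocks of length `b`, one block `x i` for each `i : I`.
The lifted space `F_2^{nb}` is `BlockVec (Fin n) b`; the coordinate `x_{i,j}` is `x i j`. -/
abbrev BlockVec (I : Type) (b : ℕ) : Type := I → Fin b → ZMod 2

/-- The pairing `⟨v, x⟩ = ∑_{i,j} v_{i,j} x_{i,j}` over `F_2`. -/
def blockDot {n b : ℕ} (v x : BlockVec (Fin n) b) : ZMod 2 :=
  ∑ i, ∑ j, v i j * x i j

/-- A set of vectors is safe if the supports of any `k` linearly independent vectors in its span
together meet at least `k` distinct blocks. -/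
def IsSafe {I : Type} {b : ℕ} (V : Set (BlockVec I b)) : Prop :=
  ∀ (k : ℕ) (w : Fin k → BlockVec I b),
    LinearIndependent (ZMod 2) w → (∀ a, w a ∈ Submodule.span (ZMod 2) V) →
      k ≤ {i : I | ∃ a j, w a i j ≠ 0}.ncard

/-- `v[∖S]`: the projection of `v` on the coordinates in the blocks outside `S`. -/
def dropBlocks {n b : ℕ} (S : Finset (Fin n)) (v : BlockVec (Fin n) b) :
    BlockVec {i : Fin n // i ∉ S} b :=
  fun i => v i

/-- `S` is a deviolator for `V` if the vectors `v[∖S]`, `v ∈ V`, form a safe set. -/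
def IsDeviolator {n b : ℕ} (V : Set (BlockVec (Fin n) b)) (S : Finset (Fin n)) : Prop :=
  IsSafe (dropBlocks S '' V)

theorem isDeviolator_univ {n b : ℕ} (V : Set (BlockVec (Fin n) b)) :
    IsDeviolator V Finset.univ := by
  intro k w hw _
  cases k with
  | zero => exact Nat.zero_le _
  | succ k =>
    exfalso
    apply hw.ne_zero 0
    funext i
    exact absurd (Finset.mem_univ i.1) i.2

theorem exists_minimal_deviolator {n b : ℕ} (V : Set (BlockVec (Fin n) b)) :
    ∃ S, Minimal (IsDeviolator V) S :=
  (Set.toFinite {S | IsDeviolator V S}).exists_minimal ⟨_, isDeviolator_univ V⟩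

/-- The closure of a set of vectors: its minimal deviolator (there is exactly one). -/
noncomputable def vecClosure {n b : ℕ} (V : Set (BlockVec (Fin n) b)) : Finset (Fin n) :=
  Classical.choose (exists_minimal_deviolator V)

theorem vecClosure_minimal {n b : ℕ} (V : Set (BlockVec (Fin n) b)) :
    Minimal (IsDeviolator V) (vecClosure V) :=
  Classical.choose_spec (exists_minimal_deviolator V)

/-- A set `S` of blocks is acceptable for `V` if, in the matrix `M` with the vectors of `V` as
rows, one can choose one column in each block of `S` such that the chosen columns are linearly
independent. The column with index `(i, j)` is `fun v : V => v i j`. -/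
def IsAcceptable {n b : ℕ} (V : Set (BlockVec (Fin n) b)) (S : Finset (Fin n)) : Prop :=
  ∃ c : {i // i ∈ S} → Fin b,
    LinearIndependent (ZMod 2) (fun s : {i // i ∈ S} => fun v : V => v.1 s.1 (c s))

/-- The indicator string of a set of blocks, ordered lexicographically. -/
def blockKey {n : ℕ} (S : Finset (Fin n)) : Lex (Fin n → Bool) :=
  toLex fun i => decide (i ∈ S)

theorem exists_lex_max_acceptable {n b : ℕ} (V : Set (BlockVec (Fin n) b)) :
    ∃ S, IsAcceptable V S ∧ ∀ T, IsAcceptable V T → blockKey T ≤ blockKey S := by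
  have h0 : IsAcceptable V ∅ :=
    ⟨fun s => absurd s.2 (Finset.notMem_empty _), linearIndependent_empty_type⟩
  obtain ⟨S, hS, hmax⟩ := Set.exists_max_image {S | IsAcceptable V S} blockKey
    (Set.toFinite _) ⟨_, h0⟩
  exact ⟨S, hS, hmax⟩

/-- The amortized closure of a set of vectors: the lexicographically largest acceptable set of
blocks. -/
noncomputable def vecAmortizedClosure {n b : ℕ} (V : Set (BlockVec (Fin n) b)) :
    Finset (Fin n) :=
  Classical.choose (exists_lex_max_acceptable V)

theorem vecAmortizedClosure_spec {n b : ℕ} (V : Set (BlockVec (Fin n) b)) :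
    IsAcceptable V (vecAmortizedClosure V) ∧
      ∀ T, IsAcceptable V T → blockKey T ≤ blockKey (vecAmortizedClosure V) :=
  Classical.choose_spec (exists_lex_max_acceptable V)

/-- The left-hand sides of all linear equations `⟨v, x⟩ = c` that hold on `A`. For nonempty `A`
these are the rows of a system `Mx = c` defining `A` (`mem_iff_definingForms`), and they are the
row space of every such system (`definingForms_eq_span`). -/
def definingForms {n b : ℕ} (A : AffineSubspace (ZMod 2) (BlockVec (Fin n) b)) :
    Set (BlockVec (Fin n) b) :=
  {v | ∃ c : ZMod 2, ∀ x ∈ A, blockDot v x = c}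

/-- `Cl(A)` -/
noncomputable def affClosure {n b : ℕ}
    (A : AffineSubspace (ZMod 2) (BlockVec (Fin n) b)) : Finset (Fin n) :=
  vecClosure (definingForms A)

/-- The amortized closure of an affine space. -/
noncomputable def affAmortizedClosure {n b : ℕ}
    (A : AffineSubspace (ZMod 2) (BlockVec (Fin n) b)) : Finset (Fin n) :=
  vecAmortizedClosure (definingForms A)

/-- Assignments to `VARS(S)`, the variables in the blocks of `S`. -/
abbrev BlockAssignment {n : ℕ} (S : Finset (Fin n)) (b : ℕ) : Type :=
  BlockVec {i : Fin n // i ∈ S} b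

/-- `C_y`: the points of the lifted space that are consistent with the partial assignment `y`. -/
def consistentSet {n b : ℕ} {S : Finset (Fin n)} (y : BlockAssignment S b) :
    Set (BlockVec (Fin n) b) :=
  {x | ∀ i : {i : Fin n // i ∈ S}, x i = y i}

/-- `y` is extendable for `A` if some point of `A` is consistent with `y`. -/
def IsExtendable {n b : ℕ} (A : AffineSubspace (ZMod 2) (BlockVec (Fin n) b))
    {S : Finset (Fin n)} (y : BlockAssignment S b) : Prop :=
  ∃ x ∈ A, x ∈ consistentSet y

/-- `G`: the gadget `g` applied to every block of an assignment. -/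
def applyGadget {I : Type} {b : ℕ} (g : (Fin b → ZMod 2) → ZMod 2) (x : BlockVec I b) :
    I → ZMod 2 :=
  fun i => g (x i)

/-- The Fourier coefficient `E_x [(-1)^{g(x)} (-1)^{∑_{i ∈ S} x_i}]`, for `x` uniform on
`F_2^b`. -/
noncomputable def gadgetFourier {b : ℕ} (g : (Fin b → ZMod 2) → ZMod 2) (S : Finset (Fin b)) :
    ℝ :=
  (∑ x : Fin b → ZMod 2, (-1 : ℝ) ^ (g x).val * (-1 : ℝ) ^ (∑ i ∈ S, x i).val) / 2 ^ b

theorem blockDot_add {n b : ℕ} (v x y : BlockVec (Fin n) b) :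
    blockDot v (x + y) = blockDot v x + blockDot v y := by
  simp [blockDot, mul_add, Finset.sum_add_distrib]

/-- Every vector outside a subspace is detected by a vector orthogonal to the subspace. -/
theorem exists_blockDot_ne_zero {n b : ℕ} (W : Submodule (ZMod 2) (BlockVec (Fin n) b))
    (v : BlockVec (Fin n) b) (hv : v ∉ W) :
    ∃ d : BlockVec (Fin n) b, (∀ w ∈ W, blockDot w d = 0) ∧ blockDot v d ≠ 0 := by
  obtain ⟨f, hf, hW⟩ := Submodule.exists_le_ker_of_notMem hv
  have key : ∀ w : BlockVec (Fin n) b,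
      blockDot w (fun i j => f (Pi.single i (Pi.single j 1))) = f w := by
    intro w
    have hw : w = ∑ i, ∑ j, w i j • (Pi.single i (Pi.single j 1) : BlockVec (Fin n) b) := by
      funext i j
      rw [Finset.sum_apply, Finset.sum_apply, Finset.sum_eq_single i]
      · rw [Finset.sum_apply, Finset.sum_apply, Finset.sum_eq_single j]
        · simp
        · intro c _ hc
          simp [Pi.single_eq_of_ne hc.symm]
        · simp
      · intro c _ hc
        simp [Finset.sum_apply, Pi.single_eq_of_ne hc.symm]
      · simp
    conv_rhs => rw [hw]
    simp only [map_sum, map_smul, smul_eq_mul, blockDot]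
  refine ⟨fun i j => f (Pi.single i (Pi.single j 1)), fun w hw => ?_, ?_⟩
  · rw [key]; exact hW hw
  · rw [key]; exact hf

theorem blockDot_comm {n b : ℕ} (v x : BlockVec (Fin n) b) : blockDot v x = blockDot x v := by
  simp [blockDot, mul_comm]

/-- The defining forms of a nonempty affine space define it. -/
theorem mem_iff_definingForms {n b : ℕ} (A : AffineSubspace (ZMod 2) (BlockVec (Fin n) b))
    (p : BlockVec (Fin n) b) (hp : p ∈ A) (x : BlockVec (Fin n) b) :
    x ∈ A ↔ ∀ v ∈ definingForms A, blockDot v x = blockDot v p := by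
  constructor
  · rintro hx v ⟨c, hc⟩
    rw [hc x hx, hc p hp]
  · intro h
    by_contra hx
    have hd : x - p ∉ A.direction := by
      intro hd
      apply hx
      have := AffineSubspace.vadd_mem_of_mem_direction hd hp
      simpa using this
    obtain ⟨v, hv, hne⟩ := exists_blockDot_ne_zero _ _ hd
    apply hne
    have hmem : v ∈ definingForms A := by
      refine ⟨blockDot v p, fun q hq => ?_⟩
      have h1 := hv _ (A.vsub_mem_direction hq hp)
      have h2 := blockDot_add v (q - p) p
      rw [vsub_eq_sub, blockDot_comm] at h1
      rw [sub_add_cancel, h1, zero_add] at h2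
      exact h2
    have h2 := blockDot_add v (x - p) p
    rw [sub_add_cancel, h v hmem] at h2
    rw [blockDot_comm]
    simpa using h2

/-- For every system of equations defining a nonempty affine space, the row space is the set of
defining forms. -/
theorem definingForms_eq_span {n b : ℕ} (A : AffineSubspace (ZMod 2) (BlockVec (Fin n) b))
    (hA : ∃ p, p ∈ A) {ι : Type} (M : ι → BlockVec (Fin n) b) (c : ι → ZMod 2)
    (h : ∀ x, x ∈ A ↔ ∀ r, blockDot (M r) x = c r) :
    definingForms A = Submodule.span (ZMod 2) (Set.range M) := by
  obtain ⟨p, hp⟩ := hA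
  ext v
  constructor
  · rintro ⟨e, he⟩
    by_contra hv
    obtain ⟨d, hd, hne⟩ := exists_blockDot_ne_zero _ _ hv
    have hq : d + p ∈ A := by
      rw [h]
      intro r
      rw [blockDot_add, hd _ (Submodule.subset_span ⟨r, rfl⟩), zero_add]
      exact (h p).1 hp r
    have h2 := he _ hq
    rw [blockDot_add, he p hp] at h2
    apply hne
    simpa using h2
  · intro hv
    induction hv using Submodule.span_induction with
    | mem v hv =>
      obtain ⟨r, rfl⟩ := hv
      exact ⟨c r, fun x hx => (h x).1 hx r⟩
    | zero => exact ⟨0, fun x _ => by simp [blockDot]⟩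
    | add u v _ _ hu hv =>
      obtain ⟨e, he⟩ := hu
      obtain ⟨e', he'⟩ := hv
      exact ⟨e + e', fun x hx => by
        rw [blockDot_comm, blockDot_add, blockDot_comm x u, blockDot_comm x v, he x hx, he' x hx]⟩
    | smul a v _ hv =>
      obtain ⟨e, he⟩ := hv
      exact ⟨a * e, fun x hx => by
        rw [← he x hx]; simp [blockDot, Finset.mul_sum, mul_assoc]⟩

/-! Let `W` be the space of forms constant on `A`, `r(U)` the dimension of its part supported on the
blocks `U`, and `S = Cl(A)`. The points to be sampled form a product set `X`: singletons in the
blocks of `S`, gadget fibres elsewhere. Counting: if `W'` satisfies `r_{W'}(S ∪ T) ≤ |T|` for all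
`T`, then any consistent system with row space `W'` has `(1 ± 1/5) · 2^{-dim W'} |X|` solutions in
`X` (`card_fiber_bounds`). In the Fourier expansion a form contributes at most `δ` for every block
outside `S` that it meets, at most `2^|T|` forms meet exactly the blocks `T` there, and `∑_T
(2δ)^|T| = (1 + 2δ)^n` is close to 1. For `A`, extendability of `y` makes the forms supported on `S`
hold on `X`; a complement of them in `W` satisfies the hypothesis and has dimension `d = dim W -
r(S)`. For `B`, independent columns in the blocks of `Ĉl(B)` outside `S` yield such a space of
dimension `m ≥ |Ĉl(B)| - |S|`, which gives an upper bound. It remains to see `m ≥ d + k`, that is,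
`|Ĉl(A)| ≥ |S| + dim W - r(S)` (`card_vecClosure_add_finrank_le`). This is matroid duality: `S`
minimizes the submodular function `|T| - r(T)`, while by Rado's theorem every maximal acceptable set
has at least `|R| + dim W - r(R)` elements for some `R`. Only inclusion-maximality of the
lexicographically largest set is needed. The ratio of the counts is then at most `(3/2) · 2^{-k} ≤
(3/4)^k` for `k ≥ 1`. -/

open Module

/-! ### Supported ranks and the closure as a minimizer. -/

/-- The vectors supported on the blocks of `U`. -/
def blockSupported {n : ℕ} (b : ℕ) (U : Finset (Fin n)) :
    Submodule (ZMod 2) (BlockVec (Fin n) b) where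
  carrier := {w | ∀ i ∉ U, w i = 0}
  zero_mem' := fun _ _ => rfl
  add_mem' := fun {u v} hu hv i hi => by simp [hu i hi, hv i hi]
  smul_mem' := fun a u hu i hi => by simp [hu i hi]

theorem mem_blockSupported {n b : ℕ} {U : Finset (Fin n)} {w : BlockVec (Fin n) b} :
    w ∈ blockSupported b U ↔ ∀ i ∉ U, w i = 0 := Iff.rfl

/-- The dimension of the space of vectors of `W` supported on the blocks of `U`. -/
noncomputable def supportedRank {n b : ℕ} (W : Submodule (ZMod 2) (BlockVec (Fin n) b))
    (U : Finset (Fin n)) : ℕ :=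
  finrank (ZMod 2) (W ⊓ blockSupported b U : Submodule (ZMod 2) (BlockVec (Fin n) b))

/-- The projection away from the blocks of `S`, as a linear map. -/
def dropBlocksLinear {n : ℕ} (b : ℕ) (S : Finset (Fin n)) :
    BlockVec (Fin n) b →ₗ[ZMod 2] BlockVec {i : Fin n // i ∉ S} b where
  toFun := dropBlocks S
  map_add' := fun _ _ => rfl
  map_smul' := fun _ _ => rfl

theorem ker_dropBlocksLinear {n b : ℕ} (S : Finset (Fin n)) :
    LinearMap.ker (dropBlocksLinear b S) = blockSupported b S := by
  ext w
  rw [LinearMap.mem_ker, mem_blockSupported]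
  exact ⟨fun h i hi => congrFun h ⟨i, hi⟩, fun h => funext fun i => h i.1 i.2⟩

theorem span_dropBlocks_image {n b : ℕ} (S : Finset (Fin n))
    (W : Submodule (ZMod 2) (BlockVec (Fin n) b)) :
    Submodule.span (ZMod 2) (dropBlocks S '' (W : Set (BlockVec (Fin n) b))) =
      W.map (dropBlocksLinear b S) := by
  have h : dropBlocks S '' (W : Set (BlockVec (Fin n) b)) =
      (W.map (dropBlocksLinear b S) : Submodule _ _) := rfl
  rw [h, Submodule.span_eq]

theorem finrank_map_add_finrank_inf_ker {K E F : Type*} [Field K] [AddCommGroup E] [Module K E]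
    [FiniteDimensional K E] [AddCommGroup F] [Module K F] (f : E →ₗ[K] F) (P : Submodule K E) :
    finrank K (P.map f) + finrank K (P ⊓ LinearMap.ker f : Submodule K E) = finrank K P := by
  have h := LinearMap.finrank_range_add_finrank_ker (f.domRestrict P)
  rw [LinearMap.range_domRestrict, LinearMap.ker_domRestrict] at h
  rw [← h, ← Submodule.finrank_map_subtype_eq, Submodule.map_comap_subtype]

theorem finrank_map_dropBlocks {n b : ℕ} (W : Submodule (ZMod 2) (BlockVec (Fin n) b))
    {S T : Finset (Fin n)} (hST : S ⊆ T) :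
    finrank (ZMod 2) ((W ⊓ blockSupported b T).map (dropBlocksLinear b S)) + supportedRank W S =
      supportedRank W T := by
  rw [supportedRank, supportedRank,
    ← finrank_map_add_finrank_inf_ker (dropBlocksLinear b S) (W ⊓ blockSupported b T),
    ker_dropBlocksLinear, inf_assoc]
  have h : blockSupported b S ≤ blockSupported b T := fun w hw i hi => hw i (fun h => hi (hST h))
  rw [inf_eq_right.2 h]

theorem ncard_subtype_eq {n : ℕ} (S U : Finset (Fin n)) :
    {i : {i : Fin n // i ∉ S} | i.1 ∈ U}.ncard = (U \ S).card := by
  rw [← Set.ncard_image_of_injective _ Subtype.val_injective, ← Set.ncard_coe_finset]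
  congr 1
  ext i
  simp [and_comm]

theorem IsSafe.finrank_le {I : Type} {b : ℕ} [Finite I] {V : Set (BlockVec I b)} (h : IsSafe V)
    (R : Submodule (ZMod 2) (BlockVec I b)) (hR : R ≤ Submodule.span (ZMod 2) V) (U : Set I)
    (hU : ∀ x ∈ R, ∀ i ∉ U, x i = 0) : finrank (ZMod 2) R ≤ U.ncard := by
  obtain ⟨e⟩ : Nonempty (Basis (Fin (finrank (ZMod 2) R)) (ZMod 2) R) := ⟨finBasis (ZMod 2) R⟩
  refine (h _ (fun a => (e a : BlockVec I b))
    (e.linearIndependent.map' R.subtype (Submodule.ker_subtype R)) fun a => hR (e a).2).trans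
    (Set.ncard_le_ncard ?_)
  rintro i ⟨a, j, hne⟩
  by_contra hi
  exact hne (congrFun (hU _ (e a).2 i hi) j)

/-- Dropping the blocks of `S` maps the forms supported on `T` onto a space of dimension `r(T) -
r(S)` living on `|T| - |S|` blocks, which safety bounds. Conversely, projected vectors meeting only
the blocks `V` lift to forms supported on `S ∪ V`. -/
theorem isDeviolator_iff {n b : ℕ} (W : Submodule (ZMod 2) (BlockVec (Fin n) b))
    (S : Finset (Fin n)) :
    IsDeviolator (W : Set (BlockVec (Fin n) b)) S ↔
      ∀ T, S ⊆ T → supportedRank W T + S.card ≤ supportedRank W S + T.card := by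
  constructor
  · intro h T hST
    have hrank := finrank_map_dropBlocks W hST
    have hcard : _ ≤ ({i : {i : Fin n // i ∉ S} | i.1 ∈ T} : Set _).ncard := IsSafe.finrank_le h
      ((W ⊓ blockSupported b T).map (dropBlocksLinear b S))
      ((Submodule.map_mono inf_le_left).trans_eq (span_dropBlocks_image S W).symm) _ (by
        rintro _ ⟨v, hv, rfl⟩ i hi
        exact hv.2 i.1 hi)
    rw [ncard_subtype_eq] at hcard
    have := Finset.card_sdiff_add_card_eq_card hST
    omega
  · intro h k w hw hmem
    rw [span_dropBlocks_image] at hmem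
    classical
    set V : Finset (Fin n) := Finset.univ.filter fun i => ∃ hi : i ∉ S, ∃ a j, w a ⟨i, hi⟩ j ≠ 0
    have hV : {i : {i : Fin n // i ∉ S} | ∃ a j, w a i j ≠ 0} = {i | i.1 ∈ V} := by
      ext i
      simp [V, i.2]
    have hVS : Disjoint V S := by
      rw [Finset.disjoint_left]
      intro i hi
      exact (Finset.mem_filter.1 hi).2.1
    have hmem' : ∀ a, w a ∈ (W ⊓ blockSupported b (S ∪ V)).map (dropBlocksLinear b S) := by
      intro a
      obtain ⟨v, hv, hva⟩ := hmem a
      refine ⟨v, ⟨hv, fun i hi => ?_⟩, hva⟩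
      have hiS : i ∉ S := fun h => hi (Finset.mem_union_left _ h)
      by_contra hne
      apply hi
      obtain ⟨j, hj⟩ := Function.ne_iff.1 hne
      refine Finset.mem_union_right _ (Finset.mem_filter.2 ⟨Finset.mem_univ _, hiS, a, j, ?_⟩)
      rw [← hva]
      exact hj
    have hle : k ≤ finrank (ZMod 2) ((W ⊓ blockSupported b (S ∪ V)).map (dropBlocksLinear b S)) := by
      have hli : LinearIndependent (ZMod 2)
          fun a => (⟨w a, hmem' a⟩ : (W ⊓ blockSupported b (S ∪ V)).map (dropBlocksLinear b S)) :=
        LinearIndependent.of_comp (Submodule.subtype _) hw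
      simpa using hli.fintype_card_le_finrank
    have hrank := finrank_map_dropBlocks W (Finset.subset_union_left : S ⊆ S ∪ V)
    have hT := h (S ∪ V) Finset.subset_union_left
    rw [hV, ncard_subtype_eq, Finset.sdiff_eq_self_of_disjoint hVS]
    rw [Finset.card_union_of_disjoint hVS.symm] at hT
    omega

/-- The subspaces for `S` and `T` intersect in the one for `S ∩ T`, and their sum lies in the one
for `S ∪ T`. -/
theorem supportedRank_supermodular {n b : ℕ} (W : Submodule (ZMod 2) (BlockVec (Fin n) b))
    (S T : Finset (Fin n)) :
    supportedRank W S + supportedRank W T ≤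
      supportedRank W (S ∪ T) + supportedRank W (S ∩ T) := by
  unfold supportedRank
  rw [← Submodule.finrank_sup_add_finrank_inf_eq]
  refine add_le_add (Submodule.finrank_mono (sup_le ?_ ?_)) (Submodule.finrank_mono ?_)
  · exact inf_le_inf_left _ fun w hw i hi => hw i fun h => hi (Finset.mem_union_left _ h)
  · exact inf_le_inf_left _ fun w hw i hi => hw i fun h => hi (Finset.mem_union_right _ h)
  · rintro w ⟨⟨hW, hS⟩, -, hT⟩
    refine ⟨hW, fun i hi => ?_⟩
    by_cases h : i ∈ S
    · exact hT i fun h' => hi (Finset.mem_inter.2 ⟨h, h'⟩)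
    · exact hS i h

/-- The closure minimizes `|T| - supportedRank W T` over all sets of blocks `T`. -/
theorem card_vecClosure_add_supportedRank_le {n b : ℕ}
    (W : Submodule (ZMod 2) (BlockVec (Fin n) b)) (T : Finset (Fin n)) :
    (vecClosure (W : Set (BlockVec (Fin n) b))).card + supportedRank W T ≤
      T.card + supportedRank W (vecClosure (W : Set (BlockVec (Fin n) b))) := by
  have hmin := vecClosure_minimal (W : Set (BlockVec (Fin n) b))
  set S := vecClosure (W : Set (BlockVec (Fin n) b))
  have hS := (isDeviolator_iff W S).1 hmin.prop
  -- A minimizer `R` among subsets of `S` is a global one: submodularity compares `T` with `S ∩ T`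
  -- and `S ∪ T`. A global minimizer is a deviolator, so minimality of `S` forces `R = S`.
  obtain ⟨R, hRS, hR⟩ := Finset.exists_min_image S.powerset
    (fun U => (U.card : ℤ) - supportedRank W U) ⟨S, Finset.mem_powerset_self S⟩
  rw [Finset.mem_powerset] at hRS
  have key : ∀ T, R.card + supportedRank W T ≤ T.card + supportedRank W R := by
    intro T
    have h1 := hR (S ∩ T) (Finset.mem_powerset.2 Finset.inter_subset_left)
    have h2 := hS (S ∪ T) Finset.subset_union_left
    have h3 := supportedRank_supermodular W S T
    have h4 := Finset.card_union_add_card_inter S T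
    omega
  have hdev : IsDeviolator (W : Set (BlockVec (Fin n) b)) R := by
    rw [isDeviolator_iff]
    intro T _
    have := key T
    omega
  have hRS' : R = S := le_antisymm hRS (hmin.le_of_le hdev hRS)
  rw [← hRS']
  exact key T

/-! ### Independent transversals and the size of the amortized closure. -/

/-- **Rado's theorem** on independent transversals, for finite sets of vectors. -/
theorem exists_independent_transversal {K E ι : Type*} [Field K] [AddCommGroup E] [Module K E]
    [FiniteDimensional K E] [DecidableEq ι] [DecidableEq E] (s : Finset ι) (C : ι → Finset E)
    (h : ∀ I ⊆ s, I.card ≤ finrank K (I.sup fun i => Submodule.span K (C i : Set E) : Submodule K E)) :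
    ∃ u : ι → E, (∀ i ∈ s, u i ∈ C i) ∧ LinearIndepOn K u (s : Set ι) := by
  -- Sets are shrunk one vector at a time, keeping the rank condition, until all are singletons.
  induction hN : ∑ i ∈ s, (C i).card using Nat.strong_induction_on generalizing C with
  | _ N ih =>
  subst hN
  by_cases hbig : ∃ i ∈ s, 1 < (C i).card
  · obtain ⟨i₀, hi₀, hcard⟩ := hbig
    obtain ⟨x, hx, y, hy, hxy⟩ := Finset.one_lt_card.1 hcard
    have step : ∀ e ∈ C i₀,
        (∃ u : ι → E, (∀ i ∈ s, u i ∈ C i) ∧ LinearIndepOn K u (s : Set ι)) ∨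
        ∃ I ⊆ s, i₀ ∉ I ∧ finrank K ((I.sup fun i => Submodule.span K (C i : Set E)) ⊔
          Submodule.span K ((C i₀).erase e : Set E) : Submodule K E) ≤ I.card := by
      intro e he
      have hsame : ∀ I : Finset ι, i₀ ∉ I →
          (I.sup fun i => Submodule.span K
            (Function.update C i₀ ((C i₀).erase e) i : Set E)) =
          I.sup fun i => Submodule.span K (C i : Set E) := by
        intro I hI
        refine Finset.sup_congr rfl fun i hi => ?_
        rw [Function.update_of_ne (ne_of_mem_of_not_mem hi hI)]
      by_cases hC : ∀ I ⊆ s, I.card ≤ finrank K (I.sup fun i => Submodule.span K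
          (Function.update C i₀ ((C i₀).erase e) i : Set E) : Submodule K E)
      · left
        have hle : ∀ i, Function.update C i₀ ((C i₀).erase e) i ⊆ C i := by
          intro i
          rcases eq_or_ne i i₀ with rfl | hi
          · simpa using Finset.erase_subset e (C i)
          · simp [Function.update_of_ne hi]
        obtain ⟨u, hu, hli⟩ := ih _ (Finset.sum_lt_sum (fun i _ => Finset.card_le_card (hle i))
          ⟨i₀, hi₀, by simpa using Finset.card_erase_lt_of_mem he⟩) _ hC rfl
        exact ⟨u, fun i hi => hle i (hu i hi), hli⟩
      · right
        push Not at hC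
        obtain ⟨J, hJs, hJ⟩ := hC
        have hmem : i₀ ∈ J := by
          by_contra hn
          rw [hsame J hn] at hJ
          exact absurd (h J hJs) (by omega)
        refine ⟨J.erase i₀, (Finset.erase_subset _ _).trans hJs, Finset.notMem_erase _ _, ?_⟩
        rw [← Finset.insert_erase hmem, Finset.sup_insert, hsame _ (Finset.notMem_erase _ _),
          Finset.card_insert_of_notMem (Finset.notMem_erase _ _), Function.update_self,
          sup_comm] at hJ
        omega
    rcases step x hx with hdone | ⟨I, hIs, hI, hIr⟩
    · exact hdone
    rcases step y hy with hdone | ⟨J, hJs, hJ, hJr⟩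
    · exact hdone
    exfalso
    -- If neither `x` nor `y` can be removed, the two obstructing spaces have dimensions at most
    -- `|I|` and `|J|`. Their sum contains everything from `I ∪ J ∪ {i₀}`, since `x ≠ y`, and their
    -- intersection everything from `I ∩ J`, so the dimensions add up to at least `|I| + |J| + 1`.
    have hmod := Submodule.finrank_sup_add_finrank_inf_eq
      ((I.sup fun i => Submodule.span K (C i : Set E)) ⊔
        Submodule.span K ((C i₀).erase x : Set E))
      ((J.sup fun i => Submodule.span K (C i : Set E)) ⊔
        Submodule.span K ((C i₀).erase y : Set E))
    have hsup := (h (insert i₀ (I ∪ J)) (Finset.insert_subset hi₀ (Finset.union_subset hIs hJs))).trans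
      (Submodule.finrank_mono (t := ((I.sup fun i => Submodule.span K (C i : Set E)) ⊔
        Submodule.span K ((C i₀).erase x : Set E)) ⊔
      ((J.sup fun i => Submodule.span K (C i : Set E)) ⊔
        Submodule.span K ((C i₀).erase y : Set E))) (by
          rw [Finset.sup_insert, Finset.sup_union]
          refine sup_le (Submodule.span_le.2 fun e he => ?_) (sup_le ?_ ?_)
          · by_cases hex : e = x
            · exact Submodule.mem_sup_right (Submodule.mem_sup_right
                (Submodule.subset_span (by simpa [hex, hxy] using hx)))
            · exact Submodule.mem_sup_left (Submodule.mem_sup_right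
                (Submodule.subset_span (by simpa [hex] using he)))
          · exact le_sup_left.trans le_sup_left
          · exact le_sup_left.trans le_sup_right))
    have hinf := (h (I ∩ J) (Finset.inter_subset_left.trans hIs)).trans
      (Submodule.finrank_mono (t := ((I.sup fun i => Submodule.span K (C i : Set E)) ⊔
        Submodule.span K ((C i₀).erase x : Set E)) ⊓
      ((J.sup fun i => Submodule.span K (C i : Set E)) ⊔
        Submodule.span K ((C i₀).erase y : Set E)))
        (le_inf ((Finset.sup_mono Finset.inter_subset_left).trans le_sup_left)
          ((Finset.sup_mono Finset.inter_subset_right).trans le_sup_left)))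
    rw [Finset.card_insert_of_notMem (by simp [hI, hJ])] at hsup
    have := Finset.card_union_add_card_inter I J
    omega
  · push Not at hbig
    have hne : ∀ i ∈ s, ∃ e, C i = {e} := by
      intro i hi
      rw [← Finset.card_eq_one]
      refine le_antisymm (hbig i hi) (Nat.one_le_iff_ne_zero.2 fun h0 => ?_)
      have := h {i} (by simpa using hi)
      rw [Finset.card_eq_zero] at h0
      simp [h0] at this
    choose! u hu using hne
    refine ⟨u, fun i hi => by simp [hu i hi], ?_⟩
    have hs := h s subset_rfl
    rw [LinearIndepOn, linearIndependent_iff_card_le_finrank_span]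
    refine le_trans (by simp) (hs.trans (Submodule.finrank_mono ?_))
    refine Finset.sup_le fun i hi => ?_
    rw [hu i hi]
    exact Submodule.span_mono (by simpa using ⟨i, hi, rfl⟩)

/-- The column `(i, j)` of the matrix with rows `W`. -/
def blockColumn {n b : ℕ} (W : Submodule (ZMod 2) (BlockVec (Fin n) b)) (i : Fin n) (j : Fin b) :
    W → ZMod 2 :=
  fun v => v.1 i j

open Classical in
/-- The columns of block `i` of the matrix with rows `W`. -/
noncomputable def blockColumns {n b : ℕ} (W : Submodule (ZMod 2) (BlockVec (Fin n) b))
    (i : Fin n) : Finset (W → ZMod 2) :=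
  Finset.univ.image (blockColumn W i)

/-- The space spanned by the columns in the blocks of `I`. -/
noncomputable def columnSpan {n b : ℕ} (W : Submodule (ZMod 2) (BlockVec (Fin n) b))
    (I : Finset (Fin n)) : Submodule (ZMod 2) (W → ZMod 2) :=
  I.sup fun i => Submodule.span (ZMod 2) (blockColumns W i : Set (W → ZMod 2))

theorem columnSpan_mono {n b : ℕ} (W : Submodule (ZMod 2) (BlockVec (Fin n) b))
    {I J : Finset (Fin n)} (h : I ⊆ J) : columnSpan W I ≤ columnSpan W J :=
  Finset.sup_mono h

theorem blockColumn_mem_columnSpan {n b : ℕ} (W : Submodule (ZMod 2) (BlockVec (Fin n) b))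
    {I : Finset (Fin n)} {i : Fin n} (hi : i ∈ I) (j : Fin b) :
    blockColumn W i j ∈ columnSpan W I :=
  Finset.le_sup (f := fun i => Submodule.span (ZMod 2) (blockColumns W i : Set (W → ZMod 2))) hi
    (Submodule.subset_span (by simp [blockColumns]))

theorem isAcceptable_iff {n b : ℕ} (W : Submodule (ZMod 2) (BlockVec (Fin n) b))
    (T : Finset (Fin n)) :
    IsAcceptable (W : Set (BlockVec (Fin n) b)) T ↔
      ∀ I ⊆ T, I.card ≤ finrank (ZMod 2) (columnSpan W I) := by
  classical
  constructor
  · rintro ⟨c, hc⟩ I hI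
    have hli : LinearIndependent (ZMod 2) fun s : {i // i ∈ I} =>
        (⟨blockColumn W s.1 (c ⟨s.1, hI s.2⟩), blockColumn_mem_columnSpan W s.2 _⟩ :
          columnSpan W I) :=
      LinearIndependent.of_comp (Submodule.subtype _)
        (hc.comp (fun s : {i // i ∈ I} => (⟨s.1, hI s.2⟩ : {i // i ∈ T}))
          fun s t hst => Subtype.ext (Subtype.mk.inj hst))
    simpa using hli.fintype_card_le_finrank
  · intro h
    obtain ⟨u, hu, hli⟩ := exists_independent_transversal T (blockColumns W) h
    have hex : ∀ s : {i // i ∈ T}, ∃ j, blockColumn W s.1 j = u s.1 := fun s => by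
      simpa [blockColumns] using hu s.1 s.2
    choose c hc using hex
    refine ⟨c, ?_⟩
    have : (fun s : {i // i ∈ T} => fun v : (W : Set (BlockVec (Fin n) b)) => v.1 s.1 (c s)) =
        fun s : {i // i ∈ T} => u s.1 := funext hc
    rw [this]
    exact hli

/-- Row rank against column rank for the matrix restricted to the blocks outside `R`: a row on which
all these columns vanish is supported on `R`. -/
theorem finrank_le_columnSpan_compl {n b : ℕ} (W : Submodule (ZMod 2) (BlockVec (Fin n) b))
    (R : Finset (Fin n)) :
    finrank (ZMod 2) W ≤ finrank (ZMod 2) (columnSpan W Rᶜ) + supportedRank W R := by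
  let f : BlockVec (Fin n) b →ₗ[ZMod 2] BlockVec {i : Fin n // i ∉ R} b := dropBlocksLinear b R
  have hrank := finrank_map_add_finrank_inf_ker f W
  rw [ker_dropBlocksLinear] at hrank
  -- Columns are bare functions on `W`; that their combinations are linear functionals makes
  -- evaluation at a row linear in the row.
  have hlin : ∀ p ∈ columnSpan W Rᶜ, ∃ F : Dual (ZMod 2) W, ∀ v, F v = p v := by
    intro p hp
    let Q : Submodule (ZMod 2) (W → ZMod 2) :=
      LinearMap.range (LinearMap.ltoFun (ZMod 2) W (ZMod 2) (ZMod 2))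
    have hle : columnSpan W Rᶜ ≤ Q := by
      refine Finset.sup_le fun i _ => Submodule.span_le.2 fun q hq => ?_
      obtain ⟨j, rfl⟩ : ∃ j, blockColumn W i j = q := by simpa [blockColumns] using hq
      exact ⟨(LinearMap.proj j).comp ((LinearMap.proj i).comp W.subtype), rfl⟩
    obtain ⟨F, hF⟩ := hle hp
    exact ⟨F, fun v => congrFun hF v⟩
  let ev : W →ₗ[ZMod 2] Dual (ZMod 2) (columnSpan W Rᶜ) :=
    { toFun := fun v =>
        { toFun := fun p => p.1 v
          map_add' := fun _ _ => rfl
          map_smul' := fun _ _ => rfl }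
      map_add' := fun v w => by
        ext p
        obtain ⟨F, hF⟩ := hlin p.1 p.2
        exact (hF _).symm.trans ((map_add F v w).trans (congrArg₂ _ (hF v) (hF w)))
      map_smul' := fun a v => by
        ext p
        obtain ⟨F, hF⟩ := hlin p.1 p.2
        exact (hF _).symm.trans ((map_smul F a v).trans (congrArg _ (hF v))) }
  have hev := LinearMap.finrank_range_add_finrank_ker ev
  have h1 : finrank (ZMod 2) (LinearMap.range ev) ≤ finrank (ZMod 2) (columnSpan W Rᶜ) :=
    (Submodule.finrank_le _).trans_eq Subspace.dual_finrank_eq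
  have h2 : finrank (ZMod 2) (LinearMap.ker ev) ≤ supportedRank W R := by
    rw [supportedRank, ← Submodule.finrank_map_subtype_eq]
    refine Submodule.finrank_mono ?_
    rintro _ ⟨v, hv, rfl⟩
    refine ⟨v.2, fun i hi => funext fun j => ?_⟩
    exact LinearMap.congr_fun (LinearMap.mem_ker.1 hv)
      ⟨blockColumn W i j, blockColumn_mem_columnSpan W (Finset.mem_compl.2 hi) j⟩
  omega

/-- Every inclusion-maximal acceptable set has at least `|R| + rank` elements for some `R`, where
the rank is that of the columns outside `R`. -/
theorem exists_card_add_finrank_le_of_maximal {n b : ℕ}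
    (W : Submodule (ZMod 2) (BlockVec (Fin n) b)) (T : Finset (Fin n))
    (hT : IsAcceptable (W : Set (BlockVec (Fin n) b)) T)
    (hmax : ∀ i ∉ T, ¬ IsAcceptable (W : Set (BlockVec (Fin n) b)) (insert i T)) :
    ∃ R : Finset (Fin n), R.card + finrank (ZMod 2) (columnSpan W Rᶜ) ≤ T.card := by
  rw [isAcceptable_iff] at hT
  -- Tight sets, whose column rank equals their size, are closed under union, so a largest one
  -- contains all the others.
  obtain ⟨I, hI, hImax⟩ := Finset.exists_max_image
    (T.powerset.filter fun I => finrank (ZMod 2) (columnSpan W I) ≤ I.card) Finset.card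
    ⟨∅, Finset.mem_filter.2 ⟨Finset.empty_mem_powerset _, by
      rw [show columnSpan W ∅ = ⊥ from Finset.sup_empty, finrank_bot, Finset.card_empty]⟩⟩
  simp only [Finset.mem_filter, Finset.mem_powerset] at hI hImax
  -- Adding `i` violates Rado's condition at some `J` containing `i`. Then `J.erase i` is tight,
  -- hence inside `I`, and already spans the columns of block `i`.
  have hcov : ∀ i ∉ T, columnSpan W {i} ≤ columnSpan W I := by
    intro i hi
    have hn := hmax i hi
    rw [isAcceptable_iff] at hn
    push Not at hn
    obtain ⟨J, hJT, hJ⟩ := hn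
    have hiJ : i ∈ J := by
      by_contra h
      have := hT J ((Finset.subset_insert_iff_of_notMem h).1 hJT)
      omega
    have hJ'T : J.erase i ⊆ T := Finset.subset_insert_iff.1 hJT
    have hJ' := hT _ hJ'T
    have hcard := Finset.card_erase_add_one hiJ
    have heq : columnSpan W (J.erase i) = columnSpan W J :=
      Submodule.eq_of_le_of_finrank_le (columnSpan_mono W (Finset.erase_subset _ _)) (by omega)
    have hunion : finrank (ZMod 2) (columnSpan W (I ∪ J.erase i)) ≤ (I ∪ J.erase i).card := by
      have hmod := Submodule.finrank_sup_add_finrank_inf_eq (columnSpan W I)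
        (columnSpan W (J.erase i))
      have hinf := (hT (I ∩ J.erase i) (Finset.inter_subset_left.trans hI.1)).trans
        (Submodule.finrank_mono (le_inf (columnSpan_mono W Finset.inter_subset_left)
          (columnSpan_mono W Finset.inter_subset_right)))
      have hsup : columnSpan W (I ∪ J.erase i) = columnSpan W I ⊔ columnSpan W (J.erase i) :=
        Finset.sup_union
      have := Finset.card_union_add_card_inter I (J.erase i)
      rw [hsup]
      have := hI.2
      rw [heq] at *
      omega
    have hle := hImax _ ⟨Finset.union_subset hI.1 hJ'T, hunion⟩
    have hIeq := Finset.eq_of_subset_of_card_le Finset.subset_union_left hle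
    calc columnSpan W {i} ≤ columnSpan W J := columnSpan_mono W (by simpa using hiJ)
      _ = columnSpan W (J.erase i) := heq.symm
      _ ≤ columnSpan W I := columnSpan_mono W (by rw [hIeq]; exact Finset.subset_union_right)
  refine ⟨T \ I, ?_⟩
  have hle : columnSpan W (T \ I)ᶜ ≤ columnSpan W I := by
    refine Finset.sup_le fun i hi => ?_
    by_cases hiT : i ∈ T
    · have hiI : i ∈ I := by
        by_contra h
        exact (Finset.mem_compl.1 hi) (Finset.mem_sdiff.2 ⟨hiT, h⟩)
      exact Finset.le_sup (f := fun i => Submodule.span (ZMod 2) (blockColumns W i : Set (W → ZMod 2))) hiI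
    · simpa [columnSpan] using hcov i hiT
  have h1 := Submodule.finrank_mono hle
  have h2 := Finset.card_sdiff_add_card_eq_card hI.1
  have := hI.2
  omega

theorem blockKey_lt_insert {n : ℕ} (T : Finset (Fin n)) {i : Fin n} (hi : i ∉ T) :
    blockKey T < blockKey (insert i T) := by
  refine ⟨i, fun j hj => ?_, ?_⟩
  · simp [blockKey, hj.ne]
  · simp [blockKey, hi]

theorem card_vecClosure_add_finrank_le {n b : ℕ} (W : Submodule (ZMod 2) (BlockVec (Fin n) b)) :
    (vecClosure (W : Set (BlockVec (Fin n) b))).card + finrank (ZMod 2) W ≤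
      (vecAmortizedClosure (W : Set (BlockVec (Fin n) b))).card +
        supportedRank W (vecClosure (W : Set (BlockVec (Fin n) b))) := by
  obtain ⟨hacc, hmax⟩ := vecAmortizedClosure_spec (W : Set (BlockVec (Fin n) b))
  obtain ⟨R, hR⟩ := exists_card_add_finrank_le_of_maximal W _ hacc
    fun i hi h => absurd (hmax _ h) (blockKey_lt_insert _ hi).not_ge
  have h1 := card_vecClosure_add_supportedRank_le W R
  have h2 := finrank_le_columnSpan_compl W R
  omega

/-! ### Character sums and counting solutions in product sets. -/

/-- The sign `(-1)^a`. -/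
noncomputable def zmodSign (a : ZMod 2) : ℝ := (-1) ^ a.val

theorem zmodSign_zero : zmodSign 0 = 1 := by simp [zmodSign]

theorem zmodSign_add (a b : ZMod 2) : zmodSign (a + b) = zmodSign a * zmodSign b := by
  have h : ∀ a b : ZMod 2, (a + b).val % 2 = (a.val + b.val) % 2 := by decide
  rw [zmodSign, zmodSign, zmodSign, ← pow_add, neg_one_pow_eq_pow_mod_two, h,
    ← neg_one_pow_eq_pow_mod_two]

theorem zmodSign_of_ne_zero {a : ZMod 2} (h : a ≠ 0) : zmodSign a = -1 := by
  have h' : ∀ a : ZMod 2, a ≠ 0 → a.val = 1 := by decide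
  simp [zmodSign, h' a h]

theorem abs_zmodSign (a : ZMod 2) : |zmodSign a| = 1 := by
  simp [zmodSign]

theorem zmodSign_sum {ι : Type*} (s : Finset ι) (f : ι → ZMod 2) :
    zmodSign (∑ i ∈ s, f i) = ∏ i ∈ s, zmodSign (f i) := by
  classical
  induction s using Finset.induction_on with
  | empty => simp [zmodSign_zero]
  | insert i s hi ih => rw [Finset.sum_insert hi, Finset.prod_insert hi, zmodSign_add, ih]

theorem blockDot_sub {n b : ℕ} (v x y : BlockVec (Fin n) b) :
    blockDot v (x - y) = blockDot v x - blockDot v y := by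
  simp [blockDot, mul_sub, Finset.sum_sub_distrib]

theorem sum_zmodSign_blockDot {n b : ℕ} (W : Submodule (ZMod 2) (BlockVec (Fin n) b))
    [Fintype W] (d : BlockVec (Fin n) b) [Decidable (∀ w ∈ W, blockDot w d = 0)] :
    ∑ w : W, zmodSign (blockDot w.1 d) =
      if ∀ w ∈ W, blockDot w d = 0 then (Fintype.card W : ℝ) else 0 := by
  split_ifs with h
  · rw [Finset.sum_congr rfl fun w _ => by rw [h w.1 w.2, zmodSign_zero]]
    simp
  · push Not at h
    obtain ⟨v, hv, hne⟩ := h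
    have hs : ∑ w : W, zmodSign (blockDot w.1 d) = ∑ w : W, -zmodSign (blockDot w.1 d) := by
      rw [← Equiv.sum_comp (Equiv.addRight (⟨v, hv⟩ : W))]
      refine Finset.sum_congr rfl fun w _ => ?_
      change zmodSign (blockDot (w.1 + v) d) = _
      rw [blockDot_comm, blockDot_add, blockDot_comm d v, zmodSign_add, zmodSign_of_ne_zero hne,
        blockDot_comm]
      ring
    rw [Finset.sum_neg_distrib] at hs
    linarith

theorem sum_piFinset_zmodSign_blockDot {n b : ℕ} (D : Fin n → Finset (Fin b → ZMod 2))
    (w : BlockVec (Fin n) b) :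
    ∑ x ∈ Fintype.piFinset D, zmodSign (blockDot w x) =
      ∏ i, ∑ t ∈ D i, zmodSign (∑ j, w i j * t j) := by
  rw [Finset.prod_univ_sum]
  exact Finset.sum_congr rfl fun x _ => zmodSign_sum _ _

/-- Grouped by the set `T` of blocks met outside `S`, each class has at most `2^|T|` forms, and the
binomial theorem sums `(2δ)^|T|`. -/
theorem sum_pow_card_support_le {n b : ℕ} (W : Submodule (ZMod 2) (BlockVec (Fin n) b))
    [Fintype W] (S : Finset (Fin n))
    (hW : ∀ T, supportedRank W (S ∪ T) ≤ T.card) {δ : ℝ} (hδ : 0 ≤ δ) :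
    ∑ w : W, δ ^ ({i ∈ Sᶜ | w.1 i ≠ 0} : Finset (Fin n)).card ≤ (1 + 2 * δ) ^ n := by
  classical
  have hmaps : ∀ w ∈ (Finset.univ : Finset W),
      ({i ∈ Sᶜ | w.1 i ≠ 0} : Finset (Fin n)) ∈ (Finset.univ : Finset (Finset (Fin n))) :=
    fun _ _ => Finset.mem_univ _
  have hcount : ∀ T : Finset (Fin n),
      ({w : W | ({i ∈ Sᶜ | w.1 i ≠ 0} : Finset (Fin n)) = T} : Finset W).card ≤ 2 ^ T.card := by
    intro T
    calc _ ≤ Fintype.card (W ⊓ blockSupported b (S ∪ T) : Submodule (ZMod 2) _) := by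
          rw [← Finset.card_univ]
          refine Finset.card_le_card_of_injOn
            (fun w => if h : w.1 ∈ W ⊓ blockSupported b (S ∪ T) then ⟨w.1, h⟩ else 0)
            (fun _ _ => Finset.mem_coe.2 (Finset.mem_univ _)) ?_
          have hmem : ∀ w ∈ ({w : W | ({i ∈ Sᶜ | w.1 i ≠ 0} : Finset (Fin n)) = T} : Finset W),
              w.1 ∈ W ⊓ blockSupported b (S ∪ T) := by
            intro w hw
            refine ⟨w.2, fun i hi => ?_⟩
            rw [Finset.mem_union, not_or, ← (Finset.mem_filter.1 hw).2] at hi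
            by_contra hne
            exact hi.2 (Finset.mem_filter.2 ⟨Finset.mem_compl.2 hi.1, hne⟩)
          intro v hv w hw hvw
          simp only [dif_pos (hmem v hv), dif_pos (hmem w hw)] at hvw
          exact Subtype.ext (Subtype.mk.inj hvw)
      _ = 2 ^ supportedRank W (S ∪ T) := by
          rw [Module.card_eq_pow_finrank (K := ZMod 2), ZMod.card, supportedRank]
      _ ≤ 2 ^ T.card := Nat.pow_le_pow_right two_pos (hW T)
  calc _ = ∑ T : Finset (Fin n), ∑ w : W with ({i ∈ Sᶜ | w.1 i ≠ 0} : Finset (Fin n)) = T,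
        δ ^ ({i ∈ Sᶜ | w.1 i ≠ 0} : Finset (Fin n)).card :=
        (Finset.sum_fiberwise_of_maps_to hmaps _).symm
    _ ≤ ∑ T : Finset (Fin n), (2 * δ) ^ T.card := by
        refine Finset.sum_le_sum fun T _ => ?_
        rw [Finset.sum_congr rfl fun w hw => by rw [(Finset.mem_filter.1 hw).2],
          Finset.sum_const, nsmul_eq_mul, mul_pow]
        exact mul_le_mul_of_nonneg_right (by exact_mod_cast hcount T) (by positivity)
    _ = (1 + 2 * δ) ^ n := by
        have h := Finset.sum_pow_mul_eq_add_pow (2 * δ) 1 (Finset.univ : Finset (Fin n))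
        simpa [add_comm] using h

/-- For a system of equations that is safe outside `S`, the number of solutions in a product of
sets that are pseudorandom outside `S` is close to its expected value. -/
theorem abs_card_mul_card_sub_le {n b : ℕ} (W : Submodule (ZMod 2) (BlockVec (Fin n) b))
    (S : Finset (Fin n)) (hW : ∀ T, supportedRank W (S ∪ T) ≤ T.card)
    (D : Fin n → Finset (Fin b → ZMod 2)) {δ : ℝ} (hδ : 0 ≤ δ)
    (hD : ∀ i ∉ S, ∀ v : Fin b → ZMod 2, v ≠ 0 →
      |∑ t ∈ D i, zmodSign (∑ j, v j * t j)| ≤ δ * (D i).card)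
    (p : BlockVec (Fin n) b) [DecidablePred fun x => ∀ w ∈ W, blockDot w x = blockDot w p] :
    |(2 : ℝ) ^ finrank (ZMod 2) W *
        ({x ∈ Fintype.piFinset D | ∀ w ∈ W, blockDot w x = blockDot w p} : Finset _).card -
      (Fintype.piFinset D).card| ≤ ((1 + 2 * δ) ^ n - 1) * (Fintype.piFinset D).card := by
  classical
  have hterm : ∀ w : BlockVec (Fin n) b, |∑ x ∈ Fintype.piFinset D, zmodSign (blockDot w x)| ≤
      δ ^ ({i ∈ Sᶜ | w i ≠ 0} : Finset (Fin n)).card * (Fintype.piFinset D).card := by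
    intro w
    have hpow : δ ^ ({i ∈ Sᶜ | w i ≠ 0} : Finset (Fin n)).card =
        ∏ i, if i ∈ Sᶜ ∧ w i ≠ 0 then δ else 1 := by
      rw [← Finset.prod_const, ← Finset.prod_filter]
      congr 1
      ext i
      simp
    rw [sum_piFinset_zmodSign_blockDot, Finset.abs_prod, Fintype.card_piFinset, Nat.cast_prod,
      hpow, ← Finset.prod_mul_distrib]
    refine Finset.prod_le_prod (fun _ _ => abs_nonneg _) fun i _ => ?_
    split_ifs with h
    · exact hD i (Finset.mem_compl.1 h.1) _ h.2
    · rw [one_mul]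
      refine (Finset.abs_sum_le_sum_abs _ _).trans ?_
      simp [abs_zmodSign]
  have hcard : (2 : ℝ) ^ finrank (ZMod 2) W = Fintype.card W := by
    rw [Module.card_eq_pow_finrank (K := ZMod 2), ZMod.card]
    norm_cast
  -- Orthogonality of characters on `W` detects the solutions; in characteristic 2 the difference `x
  -- - p` is `p + x`. The zero form gives the main term `|X|`.
  have hmain : (2 : ℝ) ^ finrank (ZMod 2) W *
      ({x ∈ Fintype.piFinset D | ∀ w ∈ W, blockDot w x = blockDot w p} : Finset _).card =
      ∑ w : W, zmodSign (blockDot w.1 p) *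
        ∑ x ∈ Fintype.piFinset D, zmodSign (blockDot w.1 x) := by
    simp_rw [Finset.mul_sum]
    rw [Finset.sum_comm, Finset.card_filter, Nat.cast_sum, Finset.mul_sum, hcard]
    refine Finset.sum_congr rfl fun x _ => ?_
    have h := sum_zmodSign_blockDot W (p + x)
    simp_rw [blockDot_add, zmodSign_add] at h
    rw [h]
    have hiff : (∀ w ∈ W, blockDot w x = blockDot w p) ↔
        ∀ w ∈ W, blockDot w p + blockDot w x = 0 :=
      forall₂_congr fun w _ => by rw [add_comm, CharTwo.add_eq_zero]
    simp [hiff]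
  have hzero : zmodSign (blockDot (0 : W).1 p) *
      ∑ x ∈ Fintype.piFinset D, zmodSign (blockDot (0 : W).1 x) = (Fintype.piFinset D).card := by
    simp [blockDot, zmodSign_zero]
  have hsum := sum_pow_card_support_le W S hW hδ
  rw [← Finset.add_sum_erase _ _ (Finset.mem_univ (0 : W))] at hsum
  rw [hmain, ← Finset.add_sum_erase _ _ (Finset.mem_univ (0 : W)), hzero, add_sub_cancel_left]
  calc _ ≤ ∑ w ∈ Finset.univ.erase (0 : W),
        δ ^ ({i ∈ Sᶜ | w.1 i ≠ 0} : Finset (Fin n)).card * ((Fintype.piFinset D).card : ℝ) := by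
        refine (Finset.abs_sum_le_sum_abs _ _).trans (Finset.sum_le_sum fun w _ => ?_)
        rw [abs_mul, abs_zmodSign, one_mul]
        exact hterm w.1
    _ ≤ _ := by
        rw [← Finset.sum_mul]
        refine mul_le_mul_of_nonneg_right ?_ (by positivity)
        simp at hsum ⊢
        linarith

/-! ### Safe subsystems obtained from closures and from acceptable sets. -/

/-- The forms whose value is constant on `A`, as a submodule. -/
def definingSubmodule {n b : ℕ} (A : AffineSubspace (ZMod 2) (BlockVec (Fin n) b)) :
    Submodule (ZMod 2) (BlockVec (Fin n) b) where
  carrier := definingForms A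
  zero_mem' := ⟨0, fun x _ => by simp [blockDot]⟩
  add_mem' := by
    rintro u v ⟨e, he⟩ ⟨f, hf⟩
    refine ⟨e + f, fun x hx => ?_⟩
    rw [blockDot_comm, blockDot_add, blockDot_comm x u, blockDot_comm x v, he x hx, hf x hx]
  smul_mem' := by
    rintro a v ⟨e, he⟩
    refine ⟨a * e, fun x hx => ?_⟩
    rw [← he x hx]
    simp [blockDot, Finset.mul_sum, mul_assoc]

theorem coe_definingSubmodule {n b : ℕ} (A : AffineSubspace (ZMod 2) (BlockVec (Fin n) b)) :
    (definingSubmodule A : Set (BlockVec (Fin n) b)) = definingForms A := rfl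

theorem blockDot_eq_zero_of_blockSupported {n b : ℕ} {S : Finset (Fin n)}
    {w d : BlockVec (Fin n) b} (hw : w ∈ blockSupported b S) (hd : ∀ i ∈ S, d i = 0) :
    blockDot w d = 0 := by
  refine Finset.sum_eq_zero fun i _ => Finset.sum_eq_zero fun j _ => ?_
  by_cases hi : i ∈ S
  · simp [hd i hi]
  · simp [hw i hi]

/-- A deviolator `S` of `W` leaves a safe system outside `S` that, together with the forms
supported on `S`, spans `W`. -/
theorem IsDeviolator.exists_complement {n b : ℕ} {W : Submodule (ZMod 2) (BlockVec (Fin n) b)}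
    {S : Finset (Fin n)} (hS : IsDeviolator (W : Set (BlockVec (Fin n) b)) S) :
    ∃ W' : Submodule (ZMod 2) (BlockVec (Fin n) b),
      W' ⊔ W ⊓ blockSupported b S = W ∧ finrank (ZMod 2) W' + supportedRank W S =
        finrank (ZMod 2) W ∧ ∀ T, supportedRank W' (S ∪ T) ≤ T.card := by
  obtain ⟨Q, hQ⟩ := Submodule.exists_isCompl (W ⊓ blockSupported b S)
  have hsup : Q ⊓ W ⊔ W ⊓ blockSupported b S = W := by
    rw [sup_comm, ← sup_inf_assoc_of_le _ inf_le_left, hQ.sup_eq_top, top_inf_eq]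
  have hdisj : (Q ⊓ W) ⊓ (W ⊓ blockSupported b S) = ⊥ :=
    (hQ.symm.disjoint.mono_left inf_le_left).eq_bot
  refine ⟨Q ⊓ W, hsup, ?_, fun T => ?_⟩
  · have h := Submodule.finrank_sup_add_finrank_inf_eq (Q ⊓ W) (W ⊓ blockSupported b S)
    rw [hsup, hdisj, finrank_bot] at h
    rw [supportedRank]
    omega
  -- Inside the forms supported on `S ∪ T`, the part from the complement is independent of the
  -- `r(S)`-dimensional part on `S`, and the deviolator inequality leaves it at most `|T|`
  -- dimensions.
  · have h := Submodule.finrank_sup_add_finrank_inf_eq (Q ⊓ W ⊓ blockSupported b (S ∪ T))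
      (W ⊓ blockSupported b S)
    have hbot : Q ⊓ W ⊓ blockSupported b (S ∪ T) ⊓ (W ⊓ blockSupported b S) = ⊥ :=
      eq_bot_mono (inf_le_inf_right _ inf_le_left) hdisj
    have hle : Q ⊓ W ⊓ blockSupported b (S ∪ T) ⊔ W ⊓ blockSupported b S ≤
        W ⊓ blockSupported b (S ∪ T) :=
      sup_le (inf_le_inf_right _ inf_le_right)
        (inf_le_inf_left _ fun w hw i hi => hw i fun h => hi (Finset.mem_union_left _ h))
    have hmono := Submodule.finrank_mono hle
    rw [hbot, finrank_bot] at h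
    have hdev := (isDeviolator_iff W S).1 hS (S ∪ T) Finset.subset_union_left
    have := Finset.card_union_le S T
    unfold supportedRank at *
    omega

/-- A functional vanishing on a proper range would be a linear relation among the `f i`. -/
theorem surjective_pi_of_linearIndependent {K E ι : Type*} [Field K] [AddCommGroup E] [Module K E]
    [Fintype ι] (f : ι → E →ₗ[K] K) (hf : LinearIndependent K f) :
    Function.Surjective (LinearMap.pi f) := by
  classical
  rw [← LinearMap.range_eq_top]
  by_contra hne
  obtain ⟨φ, hφ, hker⟩ := Submodule.exists_le_ker_of_lt_top _ (lt_top_iff_ne_top.2 hne)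
  apply hφ
  have hsum : ∑ i, φ (Pi.single i 1) • f i = 0 := by
    ext x
    have h : φ (LinearMap.pi f x) = 0 := hker ⟨x, rfl⟩
    have hsingle : ∀ i : ι, (fun j => if i = j then (1 : K) else 0) = Pi.single i 1 := fun i => by
      funext j
      rw [Pi.single_apply]
      exact if_congr eq_comm rfl rfl
    rw [LinearMap.pi_apply_eq_sum_univ] at h
    simp_rw [hsingle] at h
    simpa [mul_comm] using h
  have hz := Fintype.linearIndependent_iff.1 hf _ hsum
  refine LinearMap.pi_ext' fun i => LinearMap.ext_ring ?_
  simpa using hz i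

/-- An acceptable set `T` of `W` yields a system of at least `|T| - |S|` forms that is safe
outside `S`. -/
theorem IsAcceptable.exists_safe {n b : ℕ} {W : Submodule (ZMod 2) (BlockVec (Fin n) b)}
    {T : Finset (Fin n)} (hT : IsAcceptable (W : Set (BlockVec (Fin n) b)) T)
    (S : Finset (Fin n)) :
    ∃ W' ≤ W, T.card ≤ finrank (ZMod 2) W' + S.card ∧
      ∀ U, supportedRank W' (S ∪ U) ≤ U.card := by
  obtain ⟨c, hc⟩ := hT
  let φ : Fin n → BlockVec (Fin n) b →ₗ[ZMod 2] ZMod 2 := fun i =>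
    if h : i ∈ T then (LinearMap.proj (φ := fun _ : Fin b => ZMod 2) (c ⟨i, h⟩)).comp (LinearMap.proj i) else 0
  have hφ : ∀ i (w : BlockVec (Fin n) b), w i = 0 → φ i w = 0 := by
    intro i w hw
    by_cases h : i ∈ T <;> simp [φ, h, hw]
  let f : {i // i ∈ T \ S} → W →ₗ[ZMod 2] ZMod 2 := fun s => (φ s).comp W.subtype
  have hf : LinearIndependent (ZMod 2) f := by
    refine LinearIndependent.of_comp (LinearMap.ltoFun (ZMod 2) W (ZMod 2) (ZMod 2)) ?_
    have heq : LinearMap.ltoFun (ZMod 2) W (ZMod 2) (ZMod 2) ∘ f =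
        fun s v => v.1 s.1 (c ⟨s.1, (Finset.mem_sdiff.1 s.2).1⟩) := by
      funext s v
      have hs := (Finset.mem_sdiff.1 s.2).1
      simp [f, φ, hs]
    rw [heq]
    exact hc.comp
      (fun s : {i // i ∈ T \ S} => (⟨s.1, (Finset.mem_sdiff.1 s.2).1⟩ : {i // i ∈ T}))
      fun s t hst => Subtype.ext (Subtype.mk.inj hst)
  -- The new system is the image of a section of the evaluation at the chosen columns in `T \ S`, so
  -- its forms are determined by those entries.
  obtain ⟨r, hr⟩ := (LinearMap.pi f).exists_rightInverse_of_surjective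
    (LinearMap.range_eq_top.2 (surjective_pi_of_linearIndependent f hf))
  have hinj : Function.Injective (W.subtype.comp r) :=
    Subtype.val_injective.comp (Function.LeftInverse.injective (g := LinearMap.pi f)
      fun x => LinearMap.congr_fun hr x)
  refine ⟨LinearMap.range (W.subtype.comp r), ?_, ?_, fun U => ?_⟩
  · rintro _ ⟨x, rfl⟩
    exact (r x).2
  · rw [LinearMap.finrank_range_of_inj hinj, finrank_fintype_fun_eq_card, Fintype.card_coe]
    have := Finset.le_card_sdiff S T
    omega
  -- A form supported on `S ∪ U` vanishes at the chosen columns outside `S ∪ U`, so those in `U`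
  -- determine it: at most `|U|` dimensions.
  · have hle := LinearMap.finrank_le_finrank_of_injective (R := ZMod 2)
      (f := (LinearMap.pi fun i : {i // i ∈ U} => φ i).comp
        (LinearMap.range (W.subtype.comp r) ⊓ blockSupported b (S ∪ U)).subtype) (by
          rw [← LinearMap.ker_eq_bot, LinearMap.ker_eq_bot']
          rintro ⟨_, ⟨x, rfl⟩, hsupp⟩ hw
          have hx : x = 0 := by
            rw [← LinearMap.id_apply (R := ZMod 2) x, ← hr]
            funext s
            change φ s (r x).1 = 0
            by_cases hs : s.1 ∈ U
            · exact congrFun hw ⟨s.1, hs⟩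
            · refine hφ _ _ (hsupp _ ?_)
              rw [Finset.mem_union, not_or]
              exact ⟨(Finset.mem_sdiff.1 s.2).2, hs⟩
          simp [hx])
    rwa [finrank_fintype_fun_eq_card, Fintype.card_coe] at hle

/-! ### Pseudorandomness of the gadget fibres. -/

theorem sum_zmodSign_dot {b : ℕ} {v : Fin b → ZMod 2} (hv : v ≠ 0) :
    ∑ t : Fin b → ZMod 2, zmodSign (∑ j, v j * t j) = 0 := by
  obtain ⟨j₀, hj₀⟩ := Function.ne_iff.1 hv
  have hs : ∑ t : Fin b → ZMod 2, zmodSign (∑ j, v j * t j) =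
      ∑ t : Fin b → ZMod 2, -zmodSign (∑ j, v j * t j) := by
    rw [← Equiv.sum_comp (Equiv.addRight (Pi.single j₀ 1 : Fin b → ZMod 2))]
    refine Finset.sum_congr rfl fun t _ => ?_
    simp only [Equiv.coe_addRight, Pi.add_apply, mul_add, Finset.sum_add_distrib, zmodSign_add]
    have h : ∑ j, v j * (Pi.single j₀ 1 : Fin b → ZMod 2) j = v j₀ := by
      simp [Pi.single_apply]
    rw [h, zmodSign_of_ne_zero hj₀]
    ring
  rw [Finset.sum_neg_distrib] at hs
  linarith

/-- Twice the indicator of `g t = z` is `1 + (-1)^{z + g t}`. -/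
theorem two_mul_sum_fiber_zmodSign {b : ℕ} (g : (Fin b → ZMod 2) → ZMod 2) (z : ZMod 2)
    (v : Fin b → ZMod 2) :
    2 * ∑ t : Fin b → ZMod 2 with g t = z, zmodSign (∑ j, v j * t j) =
      ∑ t : Fin b → ZMod 2, zmodSign (∑ j, v j * t j) +
        zmodSign z * (2 ^ b * gadgetFourier g {j | v j ≠ 0}) := by
  have hfour : (2 : ℝ) ^ b * gadgetFourier g {j | v j ≠ 0} =
      ∑ t : Fin b → ZMod 2, zmodSign (g t) * zmodSign (∑ j, v j * t j) := by
    rw [gadgetFourier, mul_div_cancel₀ _ (by positivity)]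
    refine Finset.sum_congr rfl fun t _ => ?_
    have h : ∑ j with v j ≠ 0, t j = ∑ j, v j * t j := by
      rw [Finset.sum_filter]
      refine Finset.sum_congr rfl fun j _ => ?_
      generalize v j = a
      generalize t j = c
      revert a c
      decide
    rw [h]
    rfl
  rw [hfour, Finset.sum_filter, Finset.mul_sum, Finset.mul_sum, ← Finset.sum_add_distrib]
  refine Finset.sum_congr rfl fun t _ => ?_
  rw [← mul_assoc, ← zmodSign_add]
  split_ifs with h
  · rw [h, CharTwo.add_self_eq_zero, zmodSign_zero]
    ring
  · rw [zmodSign_of_ne_zero (a := z + g t) fun h' => h (CharTwo.add_eq_zero.1 h').symm]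
    ring

theorem le_two_mul_card_fiber {b : ℕ} {g : (Fin b → ZMod 2) → ZMod 2} {η : ℝ}
    (hg : ∀ S, |gadgetFourier g S| ≤ η) (z : ZMod 2) :
    2 ^ b * (1 - η) ≤ 2 * (({t | g t = z} : Finset (Fin b → ZMod 2)).card : ℝ) := by
  have h := two_mul_sum_fiber_zmodSign g z 0
  simp only [Pi.zero_apply, zero_mul, Finset.sum_const_zero, zmodSign_zero, Finset.sum_const,
    nsmul_eq_mul, mul_one, ne_eq, not_true_eq_false, Finset.filter_false, Finset.card_univ,
    Fintype.card_fun, ZMod.card, Fintype.card_fin, Nat.cast_pow, Nat.cast_ofNat] at h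
  have habs : |zmodSign z * (2 ^ b * gadgetFourier g ∅)| ≤ 2 ^ b * η := by
    rw [abs_mul, abs_zmodSign, one_mul, abs_mul, abs_of_pos (by positivity : (0 : ℝ) < 2 ^ b)]
    exact mul_le_mul_of_nonneg_left (hg _) (by positivity)
  rw [h]
  have := (abs_le.1 habs).1
  linarith

theorem abs_sum_fiber_zmodSign_le {b : ℕ} {g : (Fin b → ZMod 2) → ZMod 2} {η : ℝ}
    (hη : η ≤ 1 / 2) (hg : ∀ S, |gadgetFourier g S| ≤ η) (z : ZMod 2) {v : Fin b → ZMod 2}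
    (hv : v ≠ 0) :
    |∑ t : Fin b → ZMod 2 with g t = z, zmodSign (∑ j, v j * t j)| ≤
      2 * η * (({t | g t = z} : Finset (Fin b → ZMod 2)).card : ℝ) := by
  have h := two_mul_sum_fiber_zmodSign g z v
  rw [sum_zmodSign_dot hv, zero_add] at h
  have hη0 : 0 ≤ η := (abs_nonneg _).trans (hg ∅)
  have h2b : (0 : ℝ) < 2 ^ b := by positivity
  have habs : |2 * ∑ t : Fin b → ZMod 2 with g t = z, zmodSign (∑ j, v j * t j)| ≤ 2 ^ b * η := by
    rw [h, abs_mul, abs_zmodSign, one_mul, abs_mul, abs_of_pos h2b]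
    exact mul_le_mul_of_nonneg_left (hg _) h2b.le
  rw [abs_mul, abs_two] at habs
  have hcard := le_two_mul_card_fiber hg z
  -- A fibre has at least a quarter of all points, so the bound `2^b η / 2` on the sum becomes `2η`
  -- times the size of the fibre.
  have hhalf : (2 : ℝ) ^ b ≤ 4 * (({t | g t = z} : Finset (Fin b → ZMod 2)).card : ℝ) := by
    nlinarith
  nlinarith

/-- The factor 24 is what makes `4ηn ≤ 1/6`, whence `(1 + 4η)^n ≤ e^{1/6} ≤ 6/5`. The constant 250
leaves ample room. -/
theorem rpow_neg_le_of_le {n b : ℕ} (hn : 2 ≤ n) {α : ℝ} (hα : 0 < α)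
    (hb : 250 / α * Real.log n ≤ b) : (2 : ℝ) ^ (-(α * b)) ≤ 1 / (24 * n) := by
  have hn' : (2 : ℝ) ≤ n := by exact_mod_cast hn
  have hab : 250 * Real.log n ≤ α * b := by
    have h := mul_le_mul_of_nonneg_left hb hα.le
    rwa [← mul_assoc, mul_div_cancel₀ _ hα.ne'] at h
  have hlog : Real.log 2 ≤ Real.log n := Real.log_le_log two_pos hn'
  have hl2 := Real.log_two_gt_d9
  rw [Real.rpow_def_of_pos two_pos, one_div, ← Real.exp_log (show (0 : ℝ) < (24 * (n : ℝ))⁻¹ by positivity),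
    Real.exp_le_exp, Real.log_inv, Real.log_mul (by norm_num) (by positivity)]
  have h24 : Real.log 24 ≤ 5 * Real.log 2 := by
    rw [show (5 : ℝ) * Real.log 2 = Real.log (2 ^ 5) by rw [Real.log_pow]; norm_num]
    exact Real.log_le_log (by norm_num) (by norm_num)
  nlinarith

theorem one_add_pow_le {n : ℕ} (hn : 2 ≤ n) {η : ℝ} (hη0 : 0 ≤ η) (hη : η ≤ 1 / (24 * n)) :
    (1 + 2 * (2 * η)) ^ n ≤ 6 / 5 := by
  have hn' : (0 : ℝ) < n := by positivity
  have hmul : n * (2 * (2 * η)) ≤ 1 / 6 := by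
    rw [le_div_iff₀ (by positivity)] at hη
    linarith
  have hexp : Real.exp (1 / 6) ≤ 6 / 5 := by
    have h := Real.exp_bound_div_one_sub_of_interval (x := 1 / 6) (by norm_num) (by norm_num)
    norm_num at h ⊢
    exact h
  calc (1 + 2 * (2 * η)) ^ n ≤ Real.exp (2 * (2 * η)) ^ n :=
        pow_le_pow_left₀ (by positivity) (by linarith [Real.add_one_le_exp (2 * (2 * η))]) n
    _ = Real.exp (n * (2 * (2 * η))) := (Real.exp_nat_mul _ n).symm
    _ ≤ Real.exp (1 / 6) := Real.exp_le_exp.2 hmul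
    _ ≤ 6 / 5 := hexp

/-- The factors of the set of points that are consistent with `y` and whose blocks outside `S`
are mapped to `z` by the gadget. -/
noncomputable def fiberProduct {n b : ℕ} (g : (Fin b → ZMod 2) → ZMod 2) (z : Fin n → ZMod 2)
    {S : Finset (Fin n)} (y : BlockAssignment S b) (i : Fin n) : Finset (Fin b → ZMod 2) :=
  if h : i ∈ S then {y ⟨i, h⟩} else Finset.univ.filter fun t => g t = z i

theorem coe_piFinset_fiberProduct {n b : ℕ} {g : (Fin b → ZMod 2) → ZMod 2} {z : Fin n → ZMod 2}
    {S : Finset (Fin n)} {y : BlockAssignment S b}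
    (hz : ∀ i : {i : Fin n // i ∈ S}, applyGadget g y i = z i) :
    (Fintype.piFinset (fiberProduct g z y) : Set (BlockVec (Fin n) b)) =
      {x | applyGadget g x = z} ∩ consistentSet y := by
  ext x
  rw [Finset.mem_coe, Fintype.mem_piFinset]
  constructor
  · intro h
    have hy : x ∈ consistentSet y := fun i => by simpa [fiberProduct, i.2] using h i
    refine ⟨funext fun i => ?_, hy⟩
    by_cases hi : i ∈ S
    · exact (congrArg g (hy ⟨i, hi⟩)).trans (hz ⟨i, hi⟩)
    · simpa [fiberProduct, hi, applyGadget] using h i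
  · rintro ⟨hG, hy⟩ i
    by_cases hi : i ∈ S
    · simpa [fiberProduct, hi] using hy ⟨i, hi⟩
    · simpa [fiberProduct, hi, applyGadget] using congrFun hG i

theorem blockDot_eq_of_consistent {n b : ℕ} {S : Finset (Fin n)} {y : BlockAssignment S b}
    {w x p : BlockVec (Fin n) b} (hw : w ∈ blockSupported b S) (hx : x ∈ consistentSet y)
    (hp : p ∈ consistentSet y) : blockDot w x = blockDot w p := by
  rw [← sub_eq_zero, ← blockDot_sub]
  exact blockDot_eq_zero_of_blockSupported hw fun i hi => by
    simp [hx ⟨i, hi⟩, hp ⟨i, hi⟩]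

/-! ### Comparing the two counts. -/

/-- The errors cost a factor `(6/5)/(4/5) = 3/2`, absorbed by `(3/2)^k` once `k ≥ 1`; for `k = 0`
the inclusion suffices. -/
theorem le_three_quarters_pow_mul {d m k : ℕ} (hm : d + k ≤ m) {X NA NB : ℝ} (hX : 0 ≤ X)
    (hA : 4 / 5 * X ≤ 2 ^ d * NA) (hB : 2 ^ m * NB ≤ 6 / 5 * X) (hBA : NB ≤ NA) :
    NB ≤ (3 / 4) ^ k * NA := by
  rcases Nat.eq_zero_or_pos k with rfl | hk
  · simpa using hBA
  rcases lt_or_ge NB 0 with hneg | hNB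
  · have : 0 ≤ 2 ^ d * NA := by linarith
    have : 0 ≤ NA := nonneg_of_mul_nonneg_right this (by positivity)
    exact hneg.le.trans (by positivity)
  have h1 : (2 : ℝ) ^ (d + k) * NB ≤ 6 / 5 * X :=
    (mul_le_mul_of_nonneg_right (pow_le_pow_right₀ one_le_two hm) hNB).trans hB
  have h2 : (2 : ℝ) ^ d * (2 ^ k * NB) ≤ 2 ^ d * (3 / 2 * NA) := by
    rw [pow_add] at h1
    linarith
  have h3 : (2 : ℝ) ^ k * NB ≤ 3 / 2 * NA := le_of_mul_le_mul_left h2 (by positivity)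
  have hNA : 0 ≤ NA := hNB.trans hBA
  have h4 : (3 / 2 : ℝ) ≤ (3 / 2) ^ k := le_self_pow₀ (by norm_num) hk.ne'
  have h5 : (2 : ℝ) ^ k * NB ≤ 2 ^ k * ((3 / 4) ^ k * NA) := by
    rw [← mul_assoc, ← mul_pow]
    norm_num
    exact h3.trans (mul_le_mul_of_nonneg_right h4 hNA)
  exact le_of_mul_le_mul_left h5 (by positivity)

theorem card_fiber_bounds {n b : ℕ} (hn : 2 ≤ n) {α : ℝ} (hα : 0 < α)
    (hb : 250 / α * Real.log n ≤ b) {g : (Fin b → ZMod 2) → ZMod 2}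
    (hg : ∀ S : Finset (Fin b), |gadgetFourier g S| ≤ (2 : ℝ) ^ (-(α * b)))
    {S : Finset (Fin n)} (y : BlockAssignment S b) (z : Fin n → ZMod 2) :
    0 < (Fintype.piFinset (fiberProduct g z y)).card ∧
    ∀ W : Submodule (ZMod 2) (BlockVec (Fin n) b), (∀ T, supportedRank W (S ∪ T) ≤ T.card) →
      ∀ (p : BlockVec (Fin n) b) [DecidablePred fun x => ∀ w ∈ W, blockDot w x = blockDot w p],
      |(2 : ℝ) ^ finrank (ZMod 2) W * ({x ∈ Fintype.piFinset (fiberProduct g z y) |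
          ∀ w ∈ W, blockDot w x = blockDot w p} : Finset _).card -
        (Fintype.piFinset (fiberProduct g z y)).card| ≤
      1 / 5 * (Fintype.piFinset (fiberProduct g z y)).card := by
  have hη := rpow_neg_le_of_le hn hα hb
  set η : ℝ := (2 : ℝ) ^ (-(α * b))
  have hη0 : 0 ≤ η := (abs_nonneg _).trans (hg ∅)
  have hhalf : η ≤ 1 / 2 := hη.trans (by
    have : (2 : ℝ) ≤ n := by exact_mod_cast hn
    exact one_div_le_one_div_of_le two_pos (by linarith))
  constructor
  · rw [Finset.card_pos, Fintype.piFinset_nonempty]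
    intro i
    by_cases hi : i ∈ S
    · simp [fiberProduct, hi]
    · have h := le_two_mul_card_fiber hg (z i)
      have hpos : (0 : ℝ) < 2 ^ b * (1 - η) := by
        have : 0 < 1 - η := by linarith
        positivity
      rw [fiberProduct, dif_neg hi, ← Finset.card_pos]
      have : (0 : ℝ) < (({t | g t = z i} : Finset (Fin b → ZMod 2)).card : ℝ) := by linarith
      exact_mod_cast this
  · intro W hW p _
    refine (abs_card_mul_card_sub_le W S hW _ (δ := 2 * η) (by positivity) ?_ p).trans ?_
    · intro i hi v hv
      rw [fiberProduct, dif_neg hi]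
      exact abs_sum_fiber_zmodSign_le hhalf hg (z i) hv
    · refine mul_le_mul_of_nonneg_right ?_ (by positivity)
      linarith [one_add_pow_le hn hη0 hη]

theorem mainTheorem2 (n b : ℕ) (hn : 2 ≤ n) (α : ℝ) (hα : 0 < α)
    (hb : 250 / α * Real.log n ≤ b)
    (g : (Fin b → ZMod 2) → ZMod 2)
    (hg : ∀ S : Finset (Fin b), |gadgetFourier g S| ≤ (2 : ℝ) ^ (-(α * b)))
    (A B : AffineSubspace (ZMod 2) (BlockVec (Fin n) b)) (hBA : B ≤ A) (k : ℕ)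
    (hk : (affAmortizedClosure B).card = (affAmortizedClosure A).card + k)
    (y : BlockAssignment (affClosure A) b) (hy : IsExtendable A y)
    (z : Fin n → ZMod 2)
    (hz : ∀ i : {i : Fin n // i ∈ affClosure A}, applyGadget g y i = z i) :
    ProbabilityTheory.uniformOn ({x | applyGadget g x = z} ∩ consistentSet y)
        (A : Set (BlockVec (Fin n) b)) ≠ 0 ∧
    ProbabilityTheory.cond
        (ProbabilityTheory.uniformOn ({x | applyGadget g x = z} ∩ consistentSet y))
        (A : Set (BlockVec (Fin n) b)) (B : Set (BlockVec (Fin n) b)) ≤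
      (3 / 4 : ENNReal) ^ k := by
  classical
  obtain ⟨hXpos, hcount⟩ := card_fiber_bounds hn hα hb hg y z
  have hXeq := coe_piFinset_fiberProduct hz
  set X := Fintype.piFinset (fiberProduct g z y)
  have hXc : ∀ x ∈ X, x ∈ consistentSet y := fun x hx =>
    (hXeq.subset (Finset.mem_coe.2 hx)).2
  have hX0 : (0 : ℝ) < X.card := by exact_mod_cast hXpos
  obtain ⟨p, hpA, hpy⟩ := hy
  obtain ⟨WA, hsup, hrank, hsafe⟩ := IsDeviolator.exists_complement (W := definingSubmodule A)
    (vecClosure_minimal (definingForms A)).prop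
  -- Points of `X` agree with the extension `p` of `y` on `Cl(A)`, so within `X` the equations from
  -- `WA` alone cut out `A`.
  have hNA : 4 / 5 * (X.card : ℝ) ≤
      2 ^ finrank (ZMod 2) WA * ((X.filter (· ∈ A)).card : ℝ) := by
    have hfilter : X.filter (· ∈ A) =
        X.filter fun x => ∀ w ∈ WA, blockDot w x = blockDot w p := by
      refine Finset.filter_congr fun x hx => ?_
      rw [mem_iff_definingForms A p hpA]
      constructor
      · exact fun h w hw => h w (hsup.le (Submodule.mem_sup_left hw))
      · intro h v hv
        obtain ⟨w, hw, u, hu, rfl⟩ := Submodule.mem_sup.1 (hsup.ge hv)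
        rw [blockDot_comm, blockDot_add, blockDot_comm x w, blockDot_comm x u, h w hw,
          blockDot_eq_of_consistent hu.2 (hXc x hx) hpy, blockDot_comm (w + u) p, blockDot_add,
          blockDot_comm p w, blockDot_comm p u]
    rw [hfilter]
    have := (abs_le.1 (hcount WA hsafe p)).1
    linarith
  obtain ⟨WB, hWB, hWBcard, hWBsafe⟩ := IsAcceptable.exists_safe (W := definingSubmodule B)
    (vecAmortizedClosure_spec (definingForms B)).1 (affClosure A)
  -- Keeping only the equations from `WB` can only enlarge the solution set. Their right-hand sides
  -- are read off at a point `q` of `X ∩ B`, if there is one.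
  have hNB : 2 ^ finrank (ZMod 2) WB * ((X.filter (· ∈ B)).card : ℝ) ≤ 6 / 5 * X.card := by
    rcases (X.filter (· ∈ B)).eq_empty_or_nonempty with hempty | ⟨q, hq⟩
    · rw [hempty, Finset.card_empty, Nat.cast_zero, mul_zero]
      positivity
    · have hqB := (Finset.mem_filter.1 hq).2
      have hle : (X.filter (· ∈ B)).card ≤
          (X.filter fun x => ∀ w ∈ WB, blockDot w x = blockDot w q).card :=
        Finset.card_le_card (Finset.monotone_filter_right X fun x _ hx w hw => by
          obtain ⟨e, he⟩ := hWB hw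
          rw [he x hx, he q hqB])
      have h1 : (2 : ℝ) ^ finrank (ZMod 2) WB * ((X.filter (· ∈ B)).card : ℝ) ≤
          2 ^ finrank (ZMod 2) WB *
            ((X.filter fun x => ∀ w ∈ WB, blockDot w x = blockDot w q).card : ℝ) :=
        mul_le_mul_of_nonneg_left (by exact_mod_cast hle) (by positivity)
      have := (abs_le.1 (hcount WB hWBsafe q)).2
      linarith
  -- `dim WB ≥ |Ĉl(B)| - |Cl(A)| = |Ĉl(A)| + k - |Cl(A)| ≥ dim WA + k`.
  have hrankAB : finrank (ZMod 2) WA + k ≤ finrank (ZMod 2) WB := by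
    have h := card_vecClosure_add_finrank_le (definingSubmodule A)
    rw [coe_definingSubmodule] at h
    unfold affAmortizedClosure affClosure at *
    omega
  have hNBA : ((X.filter (· ∈ B)).card : ℝ) ≤ (X.filter (· ∈ A)).card := by
    exact_mod_cast Finset.card_le_card (Finset.monotone_filter_right X fun x _ hx => hBA hx)
  have hfinal := le_three_quarters_pow_mul hrankAB hX0.le hNA hNB hNBA
  have hNApos : 0 < (X.filter (· ∈ A)).card := by
    have h : (0 : ℝ) < 2 ^ finrank (ZMod 2) WA * ((X.filter (· ∈ A)).card : ℝ) := by linarith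
    exact_mod_cast pos_of_mul_pos_right h (by positivity)
  have hXA : (X : Set (BlockVec (Fin n) b)) ∩ A = (X.filter (· ∈ A) : Finset _) := by
    ext x
    simp
  rw [← hXeq]
  constructor
  · rw [Ne, ProbabilityTheory.uniformOn_eq_zero_iff X.finite_toSet, hXA, Finset.coe_eq_empty]
    exact (Finset.card_pos.1 hNApos).ne_empty
  · have hBcoe : (B : Set (BlockVec (Fin n) b)) = (Finset.univ.filter (· ∈ B) : Finset _) := by
      ext x
      simp
    have hint : X.filter (· ∈ A) ∩ Finset.univ.filter (· ∈ B) = X.filter (· ∈ B) := by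
      ext x
      simp only [Finset.mem_inter, Finset.mem_filter, Finset.mem_univ, true_and]
      exact ⟨fun h => ⟨h.1.1, h.2⟩, fun h => ⟨⟨h.1, hBA h.2⟩, h.2⟩⟩
    rw [ProbabilityTheory.uniformOn, ProbabilityTheory.cond_cond_eq_cond_inter
      X.measurableSet (Set.toFinite _).measurableSet, hXA, hBcoe]
    change ProbabilityTheory.uniformOn _ _ ≤ _
    rw [ProbabilityTheory.uniformOn_apply_finset, hint]
    refine ENNReal.div_le_of_le_mul ?_
    have h34 : (3 / 4 : ENNReal) = ENNReal.ofReal (3 / 4) := by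
      rw [ENNReal.ofReal_div_of_pos (by norm_num)]
      norm_num
    rw [h34, ← ENNReal.ofReal_pow (by norm_num), ← ENNReal.ofReal_natCast,
      ← ENNReal.ofReal_natCast, ← ENNReal.ofReal_mul (by positivity)]
    exact ENNReal.ofReal_le_ofReal hfinal
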